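/- Let $M$ be an oriented smooth Riemannian three-manifold with metric $g$, $\xi$ a smooth unit vector field on $M$ with metrically dual one-form $\vartheta=g(\xi,\cdot)$, and $c>0$ a constant. Let $j$ be the endomorphism of $\xi^\perp$ such that $(u,ju,\xi)$ is a positively oriented orthonormal frame for every unit vector $u\in\xi^\perp$. (The case of interest is that in which $\xi$ is a geodesible Killing field with $\mathrm{Ric}(\xi)=c$, so that $M$ is Sasakian; this is not needed for the statement. In that case $M$ stands for the complement $M\setminus K$ of a compact set outside which $\mathrm{Ric}(\xi)$ is constant.) On the cone $N=M\times(0,\infty)$, with projection $\pi:N\to M$ and coordinate $t\in(0,\infty)$, let $J$ be the almost complex structure with $J|_{\xi^\perp}=j$, $J\xi=-2t\sqrt c\,\partial_t$ and $J\partial_t=\frac{1}{2t\sqrt c}\,\xi$. Let $E\to M$ be a smooth complex vector bundle with a smooth complex-linear connection $\nabla$ with curvature $F_\nabla$, and let $\varphi$ be a smooth section of $\mathrm{End}(E)$ such that the monopole equation $\nabla\varphi=\frac12\star F_\nabla$ holds on $M$. On $\pi^*E$ consider the connection $\nabla'=d+\pi^*A_\nabla+\frac{1}{t\sqrt c}\,\pi^*\varphi\otimes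 dt$ (where $A_\nabla$ is the connection matrix of $\nabla$ in a local frame of $E$), with curvature $F_{\nabla'}$, and set $\bar\partial_E\Psi=\nabla'\Psi+\mathbf i\,J\nabla'\Psi$ for sections $\Psi$ of $\mathrm{End}(\pi^*E)$, that is, $(\bar\partial_E\Psi)(w)=\nabla'_w\Psi+\mathbf i\nabla'_{Jw}\Psi$. Connections on a bundle act on its endomorphisms by the induced connection; thus endomorphism terms in a connection act by commutator. Let $U\subseteq M$ be open, $\sigma$ a smooth section of $\xi^\perp$ over $U$ with $|\sigma|=1$, put $Z=\sigma-\mathbf i\,j\sigma$ and $\bar Z=\sigma+\mathbf i\,j\sigma$ (and denote by $Z$ also its lift to $\pi^{-1}(U)$ with no $\partial_t$-component), and let $\psi$ be a smooth section of $\mathrm{End}(E)$ over $U$. Then the equation $$\bar\partial_E\,\pi^*\psi=\iota_ZF_{\nabla'}\quad\text{on }\pi^{-1}(U)$$ is equivalent to the system $$\nabla_{\bar Z}\psi=2\mathbf i\,\nabla_\xi\varphi,\qquad \nabla_\xi\psi-2\mathbf i[\varphi,\psi]=-2\mathbf i\,\nabla_Z\varphi\quad\text{on }U .$$ With $\phi:=-2\mathbf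 i\varphi$ and $\hat\nabla:=\nabla+\phi\otimes\vartheta$, this system is in turn equivalent to $$\hat\nabla_{\bar Z}\psi=-\hat\nabla_\xi\phi,\qquad \hat\nabla_\xi\psi=\hat\nabla_Z\phi\quad\text{on }U .$$ -/

import Mathlib

open Bundle Manifold Topology Module
open scoped ContDiff

noncomputable section

/-! ### Connections on a complex vector bundle over a real manifold

A connection on a vector bundle `V → B` is handled through the map that sends a section `s` to the
`V`-valued one-form `∇ s`, so that `D s x X` is `(∇_X s)(x)`. The bundles are complex, the base
manifolds are real. -/

section Connections

variable {EB : Type*} [NormedAddCommGroup EB] [NormedSpace ℝ EB]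
  {HB : Type*} [TopologicalSpace HB] {I : ModelWithCorners ℝ EB HB}
  {B : Type*} [TopologicalSpace B] [ChartedSpace HB B] [IsManifold I 1 B]
  (F : Type*) [NormedAddCommGroup F] [NormedSpace ℂ F]
  {V : B → Type*} [TopologicalSpace (TotalSpace F V)]
  [∀ x, AddCommGroup (V x)] [∀ x, Module ℂ (V x)] [∀ x, TopologicalSpace (V x)]
  [FiberBundle F V]

/-- The curvature `F_∇(X, Y) e = ∇_X ∇_Y s - ∇_Y ∇_X s - ∇_{[X, Y]} s` at the point `x`, where the
tangent vectors `X`, `Y` and the fibre element `e` are extended to vector fields and to a section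
`s` that are smooth near `x` (the value does not depend on the extensions). -/
def curvature (D : (Π x : B, V x) → (Π x : B, TangentSpace I x →L[ℝ] V x))
    (x : B) (X Y : TangentSpace I x) (e : V x) : V x :=
  D (fun y ↦ D (FiberBundle.extend F e) y (FiberBundle.extend EB Y y)) x X
    - D (fun y ↦ D (FiberBundle.extend F e) y (FiberBundle.extend EB X y)) x Y
    - D (FiberBundle.extend F e) x
        (VectorField.mlieBracket I (FiberBundle.extend EB X) (FiberBundle.extend EB Y) x)

/-- The connection induced on the endomorphism bundle: `(∇_X ψ) e = ∇_X (ψ s) - ψ (∇_X s)`, where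
`s` is a section, smooth near `x`, with `s x = e` (the value does not depend on `s`). -/
def endDeriv (D : (Π x : B, V x) → (Π x : B, TangentSpace I x →L[ℝ] V x))
    (ψ : Π x : B, V x →L[ℂ] V x) (x : B) (X : TangentSpace I x) (e : V x) : V x :=
  D (fun y ↦ ψ y (FiberBundle.extend F e y)) x X - ψ x (D (FiberBundle.extend F e) x X)

end Connections

/-- Smoothness on `U` of the section `ψ` of the endomorphism bundle of a complex vector bundle: it is
smooth as a section of the bundle of real linear endomorphisms. -/
def SmoothEndOn {EB : Type*} [NormedAddCommGroup EB] [NormedSpace ℝ EB]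
    {HB : Type*} [TopologicalSpace HB] (I : ModelWithCorners ℝ EB HB)
    {B : Type*} [TopologicalSpace B] [ChartedSpace HB B]
    (F : Type*) [NormedAddCommGroup F] [NormedSpace ℂ F]
    {V : B → Type*} [TopologicalSpace (TotalSpace F V)]
    [∀ x, AddCommGroup (V x)] [∀ x, Module ℂ (V x)] [∀ x, TopologicalSpace (V x)]
    [∀ x, IsTopologicalAddGroup (V x)] [∀ x, ContinuousSMul ℝ (V x)]
    [FiberBundle F V] [VectorBundle ℝ F V]
    (ψ : Π x : B, V x →L[ℂ] V x) (U : Set B) : Prop :=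
  ContMDiffOn I (I.prod 𝓘(ℝ, F →L[ℝ] F)) ∞
    (fun x ↦ TotalSpace.mk' (F →L[ℝ] F) (E := fun x ↦ V x →L[ℝ] V x) x
      ((ψ x).restrictScalars ℝ)) U

/-- The value on the complex vector `a + i b`, given by the pair `(a, b)` of real vectors, of the
complex linear extension of a real linear map `L`. -/
def cext {T W : Type*} [AddCommGroup W] [Module ℂ W] (L : T → W) (z : T × T) : W :=
  L z.1 + Complex.I • L z.2

/-! ### Oriented Riemannian three-manifolds -/

section Riemannian

variable {M : Type*} [TopologicalSpace M] [ChartedSpace (EuclideanSpace ℝ (Fin 3)) M]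

instance instFactFinrankTangentSpaceThree (p : M) : Fact (finrank ℝ (TangentSpace (𝓡 3) p) = 3) :=
  ⟨finrank_euclideanSpace_fin⟩

instance instFiniteDimensionalTangentSpaceThree (p : M) :
    FiniteDimensional ℝ (TangentSpace (𝓡 3) p) :=
  inferInstanceAs (FiniteDimensional ℝ (EuclideanSpace ℝ (Fin 3)))

variable (M) in
/-- An orientation of a three-manifold: an orientation of every tangent space which, near every
point, is the one given by a smooth local frame. -/
structure ManifoldOrientation [IsManifold (𝓡 3) ∞ M] where
  /-- the orientation of the tangent space at a point -/
  orient (p : M) : Orientation ℝ (TangentSpace (𝓡 3) p) (Fin 3)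
  exists_frame (p : M) : ∃ X : Fin 3 → Π q : M, TangentSpace (𝓡 3) q,
    (∀ i, ContMDiffAt (𝓡 3) (𝓡 3).tangent ∞ (fun q ↦ (⟨q, X i q⟩ : TangentBundle (𝓡 3) M)) p) ∧
    ∀ᶠ q in 𝓝 p, ∃ b : Basis (Fin 3) ℝ (TangentSpace (𝓡 3) q),
      (∀ i, b i = X i q) ∧ b.orientation = orient q

variable [RiemannianBundle (fun p : M ↦ TangentSpace (𝓡 3) p)]

/-- The Hodge star of a two-form `α` on an oriented three-dimensional tangent space, with values in
a real vector space: `(⋆ α)(v) = ½ ∑ i j, vol(e i, e j, v) α(e i, e j)` for an orthonormal basis `e`,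
so that `(⋆ α)(e₃) = α(e₁, e₂)` for a positively oriented orthonormal basis. -/
def hodgeStar {p : M} (o : Orientation ℝ (TangentSpace (𝓡 3) p) (Fin 3))
    {W : Type*} [AddCommGroup W] [Module ℝ W]
    (α : TangentSpace (𝓡 3) p → TangentSpace (𝓡 3) p → W) (v : TangentSpace (𝓡 3) p) : W :=
  (1 / 2 : ℝ) • ∑ i, ∑ j,
    o.volumeForm ![stdOrthonormalBasis ℝ (TangentSpace (𝓡 3) p) i,
        stdOrthonormalBasis ℝ (TangentSpace (𝓡 3) p) j, v] •
      α (stdOrthonormalBasis ℝ (TangentSpace (𝓡 3) p) i)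
        (stdOrthonormalBasis ℝ (TangentSpace (𝓡 3) p) j)

/-- The endomorphism `j` attached to a unit vector `ξ` of an oriented three-dimensional tangent
space: `j v` is the vector with `⟨j v, w⟩ = vol(ξ, v, w)` for all `w`. Hence `j ξ = 0`, and
`(u, j u, ξ)` is a positively oriented orthonormal basis for every unit vector `u ∈ ξ^⊥`. -/
def transverseJ {p : M} (o : Orientation ℝ (TangentSpace (𝓡 3) p) (Fin 3))
    (ξ v : TangentSpace (𝓡 3) p) : TangentSpace (𝓡 3) p :=
  ∑ i, o.volumeForm ![ξ, v, stdOrthonormalBasis ℝ (TangentSpace (𝓡 3) p) i] •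
    stdOrthonormalBasis ℝ (TangentSpace (𝓡 3) p) i

/-! ### The cone `M × (0, ∞)`

The cone is the open set `t > 0` of the manifold `M × ℝ`; all objects below are used there only. A
tangent vector at `(p, t)` is a pair `(v, τ)`, standing for `v + τ ∂/∂t`. -/

/-- The almost complex structure of the cone at `(p, t)`: on `ξ^⊥` it is `j`, and
`J (∂/∂t) = ξ / (2 t √c)`, `J ξ = - 2 t √c ∂/∂t`. -/
def coneJ (o : Π p : M, Orientation ℝ (TangentSpace (𝓡 3) p) (Fin 3))
    (ξ : Π p : M, TangentSpace (𝓡 3) p) (c : ℝ) (x : M × ℝ)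
    (w : TangentSpace ((𝓡 3).prod 𝓘(ℝ, ℝ)) x) : TangentSpace ((𝓡 3).prod 𝓘(ℝ, ℝ)) x :=
  letI v : TangentSpace (𝓡 3) x.1 := w.1
  letI τ : ℝ := w.2
  (transverseJ (o x.1) (ξ x.1) v + (τ / (2 * x.2 * √c)) • ξ x.1,
    -(2 * x.2 * √c) * inner ℝ (ξ x.1) v)

end Riemannian

section Cone

variable (M : Type*) [TopologicalSpace M] [ChartedSpace (EuclideanSpace ℝ (Fin 3)) M]

/-- The projection `π (p, t) = p`. -/
abbrev coneProj : C^∞⟮(𝓡 3).prod 𝓘(ℝ, ℝ), M × ℝ; 𝓡 3, M⟯ := ContMDiffMap.fst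

variable {M}

/-- The tangent vector `v` of `M` as a tangent vector `v + 0 ∂/∂t` of the cone. -/
def horizontalLift (x : M × ℝ) (v : TangentSpace (𝓡 3) x.1) :
    TangentSpace ((𝓡 3).prod 𝓘(ℝ, ℝ)) x :=
  (v, (0 : ℝ))

/-- The pull-back bundle `π^* E`, with fibre `E p` at `(p, t)`. Its bundle structure is the one of
`Bundle.Pullback`. -/
def ConePullback (E : M → Type*) : M × ℝ → Type _ := fun x ↦ E x.1

section Instances

variable (F : Type*) [NormedAddCommGroup F] [NormedSpace ℂ F] (E : M → Type*)
  [∀ p, AddCommGroup (E p)] [∀ p, Module ℂ (E p)] [∀ p, TopologicalSpace (E p)]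

instance instAddCommGroupConePullback (x : M × ℝ) : AddCommGroup (ConePullback E x) :=
  inferInstanceAs (AddCommGroup (E x.1))

instance instModuleConePullback (x : M × ℝ) : Module ℂ (ConePullback E x) :=
  inferInstanceAs (Module ℂ (E x.1))

instance instTopologicalSpaceConePullback (x : M × ℝ) : TopologicalSpace (ConePullback E x) :=
  inferInstanceAs (TopologicalSpace (E x.1))

instance instIsTopologicalAddGroupConePullback [∀ p, IsTopologicalAddGroup (E p)] (x : M × ℝ) :
    IsTopologicalAddGroup (ConePullback E x) :=
  inferInstanceAs (IsTopologicalAddGroup (E x.1))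

instance instContinuousSMulConePullback [∀ p, ContinuousSMul ℂ (E p)] (x : M × ℝ) :
    ContinuousSMul ℂ (ConePullback E x) :=
  inferInstanceAs (ContinuousSMul ℂ (E x.1))

instance instContinuousSMulRealConePullback [∀ p, ContinuousSMul ℝ (E p)] (x : M × ℝ) :
    ContinuousSMul ℝ (ConePullback E x) :=
  inferInstanceAs (ContinuousSMul ℝ (E x.1))

variable [TopologicalSpace (TotalSpace F E)]

instance instTopologicalSpaceTotalSpaceConePullback :
    TopologicalSpace (TotalSpace F (ConePullback E)) :=
  inferInstanceAs (TopologicalSpace (TotalSpace F (coneProj M *ᵖ E)))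

variable [FiberBundle F E]

instance instFiberBundleConePullback : FiberBundle F (ConePullback E) :=
  inferInstanceAs (FiberBundle F (coneProj M *ᵖ E))

instance instVectorBundleConePullback [VectorBundle ℂ F E] : VectorBundle ℂ F (ConePullback E) :=
  inferInstanceAs (VectorBundle ℂ F (coneProj M *ᵖ E))

instance instVectorBundleRealConePullback [VectorBundle ℝ F E] :
    VectorBundle ℝ F (ConePullback E) :=
  inferInstanceAs (VectorBundle ℝ F (coneProj M *ᵖ E))

instance instContMDiffVectorBundleConePullback [VectorBundle ℝ F E]
    [ContMDiffVectorBundle ∞ F E (𝓡 3)] :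
    ContMDiffVectorBundle ∞ F (ConePullback E) ((𝓡 3).prod 𝓘(ℝ, ℝ)) :=
  inferInstanceAs (ContMDiffVectorBundle ∞ F (coneProj M *ᵖ E) ((𝓡 3).prod 𝓘(ℝ, ℝ)))

end Instances

variable {E : M → Type*} [∀ p, AddCommGroup (E p)] [∀ p, Module ℂ (E p)]
  [∀ p, TopologicalSpace (E p)]

/-- The endomorphism `π^* ψ` of the pull-back bundle `π^* E`. -/
def pullbackEnd (ψ : Π p : M, E p →L[ℂ] E p) (x : M × ℝ) :
    ConePullback E x →L[ℂ] ConePullback E x :=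
  ψ x.1

variable [∀ p, IsTopologicalAddGroup (E p)] [∀ p, ContinuousSMul ℝ (E p)]

/-- The connection `∇' = d + π^* A_∇ + (1 / (t √c)) π^* φ ⊗ dt` on `π^* E`: for a section `S` of
`π^* E`,
`∇'_{v + τ ∂/∂t} S = ∇_v (S(·, t)) + τ (∂S/∂t + (1 / (t √c)) φ S)` at `(p, t)`. -/
def coneConnection (D : (Π p : M, E p) → (Π p : M, TangentSpace (𝓡 3) p →L[ℝ] E p))
    (φ : Π p : M, E p →L[ℂ] E p) (c : ℝ) (S : Π x : M × ℝ, ConePullback E x) (x : M × ℝ) :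
    TangentSpace ((𝓡 3).prod 𝓘(ℝ, ℝ)) x →L[ℝ] ConePullback E x :=
  letI horizontal : TangentSpace (𝓡 3) x.1 →L[ℝ] E x.1 := D (fun q ↦ (S (q, x.2) : E q)) x.1
  letI vertical : E x.1 :=
    deriv (fun t : ℝ ↦ (S (x.1, t) : E x.1)) x.2 + (1 / (x.2 * √c)) • φ x.1 (S x)
  (horizontal.comp (ContinuousLinearMap.fst ℝ (TangentSpace (𝓡 3) x.1) ℝ)
    + (ContinuousLinearMap.snd ℝ (TangentSpace (𝓡 3) x.1) ℝ).smulRight vertical :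
      TangentSpace (𝓡 3) x.1 × ℝ →L[ℝ] E x.1)

/-- The connection `∇̂ = ∇ + ϕ ⊗ ϑ` on `E`, where `ϕ = -2 i φ` and `ϑ` is the one-form metrically
dual to `ξ`. -/
def hatConnection [RiemannianBundle (fun p : M ↦ TangentSpace (𝓡 3) p)]
    (D : (Π p : M, E p) → (Π p : M, TangentSpace (𝓡 3) p →L[ℝ] E p))
    (ξ : Π p : M, TangentSpace (𝓡 3) p) (ϕ : Π p : M, E p →L[ℂ] E p)
    (s : Π p : M, E p) (p : M) : TangentSpace (𝓡 3) p →L[ℝ] E p :=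
  D s p + (innerSL ℝ (ξ p)).smulRight (ϕ p (s p))

end Cone

end

/-! Write × for the cross product, so that j = ξ × · on ξ^⊥. In dimension three a two-form is
recovered from its Hodge star by α(v, w) = (⋆α)(v × w) (`hodgeStar_transverseJ`), so the monopole
equation says F_∇(v, w) = 2 ∇_{v × w} φ. On the cone, F_∇'(v, u + τ ∂_t) = F_∇(v, u) + (τ / (t√c))
∇_v φ (`curvature_coneConnection`), and ∇'_{v + τ ∂_t} π^*ψ = ∇_v ψ + (τ / (t√c)) [φ, ψ]
(`endDeriv_coneConnection`). Both sides of the Cauchy-Riemann equation thus become expressions in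
∇ψ, ∇φ and [φ, ψ] on M.

Let P and Q be the differences of the two sides in the first and second equation of the coupled
system. At w = a σ + b jσ + n ξ + τ ∂_t the Cauchy-Riemann equation has residual (a - i b) P + (n +
i τ / (2t√c)) Q (`cauchyRiemann_residual_identity`). Conceptually, the residual is a form of type
(0,1) on a space of complex dimension two, hence determined by its values P at σ and Q at ξ. It
vanishes for all w exactly when P = Q = 0, and this condition does not involve t.

For the hatted system, ϑ annihilates Z and its conjugate, and ϕ commutes with itself. So passing to
∇̂ changes only ∇_ξ ψ, by the term [ϕ, ψ] = -2i [φ, ψ]. -/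

/-! ### Extensions of vectors that are constant in a trivialization -/

section Extend

variable {EB : Type*} [NormedAddCommGroup EB] [NormedSpace ℝ EB]
  {HB : Type*} [TopologicalSpace HB] {I : ModelWithCorners ℝ EB HB}
  {B : Type*} [TopologicalSpace B] [ChartedSpace HB B]

section VectorBundle

variable (F : Type*) [NormedAddCommGroup F] [NormedSpace ℝ F]
  {V : B → Type*} [TopologicalSpace (TotalSpace F V)]
  [∀ x, AddCommGroup (V x)] [∀ x, Module ℝ (V x)] [∀ x, TopologicalSpace (V x)]
  [FiberBundle F V] [VectorBundle ℝ F V]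

theorem extend_eq_symmL {x y : B} (hy : y ∈ (trivializationAt F V x).baseSet) (v : V x) :
    FiberBundle.extend F v y = (trivializationAt F V x).symmL ℝ y
      ((trivializationAt F V x).continuousLinearMapAt ℝ x v) := by
  have hx : x ∈ (trivializationAt F V x).baseSet := FiberBundle.mem_baseSet_trivializationAt' x
  simp [FiberBundle.extend, Bundle.Trivialization.symmL_apply, hy,
    Bundle.Trivialization.coe_linearMapAt_of_mem _ hx]

theorem eventually_extend_add_smul {x : B} (a b : ℝ) (v w : V x) :
    ∀ᶠ y in 𝓝 x, FiberBundle.extend F (a • v + b • w) y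
      = a • FiberBundle.extend F v y + b • FiberBundle.extend F w y := by
  filter_upwards [(trivializationAt F V x).open_baseSet.mem_nhds
    (FiberBundle.mem_baseSet_trivializationAt' x)] with y hy
  simp only [extend_eq_symmL F hy, map_add, map_smul]

end VectorBundle

section Tangent

variable [IsManifold I 1 B]

theorem tangent_extend_eq {x y : B} (hy : y ∈ (chartAt HB x).source) (v : TangentSpace I x) :
    FiberBundle.extend EB v y
      = mfderivWithin 𝓘(ℝ, EB) I (extChartAt I x).symm (Set.range I) (extChartAt I x y) v := by
  rw [extend_eq_symmL EB (by simpa using hy), TangentBundle.symmL_trivializationAt hy,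
    TangentBundle.continuousLinearMapAt_trivializationAt (mem_chart_source HB x),
    mfderiv_extChartAt_self]
  rfl

/-- In the chart at `x` both extensions are constant vector fields, and constant fields commute.
This removes the bracket term from every curvature below. -/
theorem mlieBracket_extend {x : B} (v w : TangentSpace I x) :
    VectorField.mlieBracket I (FiberBundle.extend EB v) (FiberBundle.extend EB w) x = 0 := by
  have key : ∀ u : TangentSpace I x,
      VectorField.mpullbackWithin 𝓘(ℝ, EB) I (extChartAt I x).symm (FiberBundle.extend EB u)
        (Set.range I) =ᶠ[𝓝[Set.range I] (extChartAt I x x)] fun _ ↦ u := by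
    intro u
    filter_upwards [extChartAt_target_mem_nhdsWithin x] with z hz
    have hs : (extChartAt I x).symm z ∈ (chartAt HB x).source := by
      rw [← extChartAt_source I]; exact (extChartAt I x).map_target hz
    rw [VectorField.mpullbackWithin_apply, tangent_extend_eq hs, (extChartAt I x).right_inv hz]
    exact (isInvertible_mfderivWithin_extChartAt_symm hz).inverse_apply_eq.2 rfl
  rw [← VectorField.mlieBracketWithin_univ, VectorField.mlieBracketWithin_apply]
  rw [Set.preimage_univ, Set.univ_inter,
    (key v).lieBracketWithin_vectorField_eq_of_mem (key w) (Set.mem_range_self _)]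
  have h0 (a b : EB) : VectorField.lieBracketWithin ℝ (fun _ : EB ↦ a) (fun _ ↦ b)
      (Set.range I) (extChartAt I x x) = 0 := by
    simp [VectorField.lieBracketWithin]
  exact (congrArg _ (h0 v w)).trans (map_zero (mfderiv% (extChartAt I x) x).inverse)

end Tangent

end Extend

/-! ### Extensions on the cone and on the pull-back bundle -/

section Cone

variable {M : Type*} [TopologicalSpace M] [ChartedSpace (EuclideanSpace ℝ (Fin 3)) M]

/-- The fibre at `y` is read in the chart at `y`, so extending from `x` amounts to differentiating
the transition map. In this form the product structure of the cone is visible. -/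
theorem tangent_extend_eq_fderivWithin {EB : Type*} [NormedAddCommGroup EB] [NormedSpace ℝ EB]
    {HB : Type*} [TopologicalSpace HB] {I : ModelWithCorners ℝ EB HB}
    {B : Type*} [TopologicalSpace B] [ChartedSpace HB B] [IsManifold I 1 B]
    {x y : B} (hy : y ∈ (chartAt HB x).source) (v : TangentSpace I x) :
    FiberBundle.extend EB v y
      = fderivWithin ℝ (extChartAt I y ∘ (extChartAt I x).symm) (Set.range I)
          (extChartAt I x y) v := by
  rw [extend_eq_symmL EB (by simpa using hy), TangentBundle.symmL_trivializationAt_eq_core hy,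
    TangentBundle.continuousLinearMapAt_trivializationAt (mem_chart_source HB x),
    mfderiv_extChartAt_self]
  rfl

/-- The tangent vector `v + τ ∂/∂t` of the cone. -/
def coneVector (x : M × ℝ) (v : TangentSpace (𝓡 3) x.1) (τ : ℝ) :
    TangentSpace ((𝓡 3).prod 𝓘(ℝ, ℝ)) x :=
  (v, τ)

/-- Transition maps of the cone are those of M times the identity in t, so the ∂_t-component of an
extension stays constant. -/
theorem extend_coneVector [IsManifold (𝓡 3) ∞ M] {x y : M × ℝ}
    (hy : y.1 ∈ (chartAt (EuclideanSpace ℝ (Fin 3)) x.1).source)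
    (v : TangentSpace (𝓡 3) x.1) (τ : ℝ) :
    FiberBundle.extend (EuclideanSpace ℝ (Fin 3) × ℝ) (coneVector x v τ) y
      = coneVector y (FiberBundle.extend (EuclideanSpace ℝ (Fin 3)) v y.1) τ := by
  have hM : IsManifold (𝓡 3) 1 M := IsManifold.of_le (n := ∞) (by simp)
  have hy' : y ∈ (chartAt (ModelProd (EuclideanSpace ℝ (Fin 3)) ℝ) x).source := by
    rw [prodChartedSpace_chartAt]
    exact ⟨hy, by rw [chartAt_self_eq]; trivial⟩
  rw [tangent_extend_eq_fderivWithin hy', tangent_extend_eq_fderivWithin hy]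
  have hd : DifferentiableAt ℝ (extChartAt (𝓡 3) y.1 ∘ (extChartAt (𝓡 3) x.1).symm)
      (extChartAt (𝓡 3) x.1 y.1) := by
    have := contDiffWithinAt_ext_coord_change (I := 𝓡 3) (n := 1) y.1 x.1
      (y := extChartAt (𝓡 3) x.1 y.1) (by
        simp [(chartAt _ x.1).map_source hy, (chartAt _ x.1).left_inv hy])
    rw [(𝓡 3).range_eq_univ] at this
    exact (contDiffWithinAt_univ.1 this).differentiableAt one_ne_zero
  have hf : (extChartAt ((𝓡 3).prod 𝓘(ℝ, ℝ)) y ∘ (extChartAt ((𝓡 3).prod 𝓘(ℝ, ℝ)) x).symm)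
      = Prod.map (extChartAt (𝓡 3) y.1 ∘ (extChartAt (𝓡 3) x.1).symm) id := by
    rfl
  have hr : Set.range ((𝓡 3).prod 𝓘(ℝ, ℝ)) = Set.univ :=
    ((𝓡 3).prod 𝓘(ℝ, ℝ)).range_eq_univ
  have hr' : Set.range (𝓡 3) = Set.univ := (𝓡 3).range_eq_univ
  rw [hf, hr, hr', fderivWithin_univ, fderivWithin_univ]
  have h := hd.hasFDerivAt.prodMap (extChartAt (𝓡 3) x.1 y.1, y.2)
    (hasFDerivAt_id (𝕜 := ℝ) y.2)
  exact congrArg (fun L : EuclideanSpace ℝ (Fin 3) × ℝ →L[ℝ] EuclideanSpace ℝ (Fin 3) × ℝ ↦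
    L (v, τ)) h.fderiv

variable (F : Type*) [NormedAddCommGroup F] [NormedSpace ℂ F] {E : M → Type*}
  [TopologicalSpace (TotalSpace F E)]
  [∀ p, AddCommGroup (E p)] [∀ p, Module ℂ (E p)] [∀ p, TopologicalSpace (E p)]
  [FiberBundle F E]

omit [NormedSpace ℂ F] [∀ p, Module ℂ (E p)] in
theorem extend_conePullback {x : M × ℝ} (e : ConePullback E x) (y : M × ℝ) :
    FiberBundle.extend F e y
      = (FiberBundle.extend F (E := E) (x := x.1) e y.1 : E y.1) := by
  have key (w : F) : (trivializationAt F (ConePullback E) x).symm y w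
      = (trivializationAt F E x.1).symm y.1 w := by
    by_cases hy : y.1 ∈ (trivializationAt F E x.1).baseSet
    · have hy' : y ∈ (trivializationAt F (ConePullback E) x).baseSet := hy
      exact ((trivializationAt F (ConePullback E) x).symm_apply hy' w).trans rfl
    -- Off the base set both inverses return the same arbitrary default element, so the equality
    -- holds everywhere and not only near `x`.
    · have hy' : y ∉ (trivializationAt F (ConePullback E) x).baseSet := hy
      have h : (trivializationAt F E x.1).symm y.1 w = Classical.arbitrary (E y.1) := dif_neg hy
      exact (dif_neg hy').trans h.symm
  exact key _

end Cone

/-! ### Cross product and Hodge star in dimension three -/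

section Cross

variable {M : Type*} [TopologicalSpace M] [ChartedSpace (EuclideanSpace ℝ (Fin 3)) M]
  [RiemannianBundle (fun p : M ↦ TangentSpace (𝓡 3) p)]

variable (M) in
/-- The standard orthonormal basis of a three-dimensional tangent space, indexed by `Fin 3`. -/
noncomputable def tangentONB (p : M) : OrthonormalBasis (Fin 3) ℝ (TangentSpace (𝓡 3) p) :=
  (stdOrthonormalBasis ℝ (TangentSpace (𝓡 3) p)).reindex
    (finCongr (Fact.out : finrank ℝ (TangentSpace (𝓡 3) p) = 3))

theorem exists_volumeForm_eq {p : M} (o : Orientation ℝ (TangentSpace (𝓡 3) p) (Fin 3)) :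
    ∃ ε : ℝ, ε * ε = 1 ∧ ∀ x y z : TangentSpace (𝓡 3) p, o.volumeForm ![x, y, z] =
      ε * Matrix.det (Matrix.of fun i j ↦ (tangentONB M p).repr (![x, y, z] j) i) := by
  by_cases h : (tangentONB M p).toBasis.orientation = o
  · refine ⟨1, by norm_num, fun x y z ↦ ?_⟩
    rw [o.volumeForm_robust (tangentONB M p) h, one_mul]
    rfl
  · refine ⟨-1, by norm_num, fun x y z ↦ ?_⟩
    rw [o.volumeForm_robust_neg (tangentONB M p) h, neg_one_mul]
    rfl

theorem transverseJ_eq_sum {p : M} (o : Orientation ℝ (TangentSpace (𝓡 3) p) (Fin 3))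
    (x y : TangentSpace (𝓡 3) p) :
    transverseJ o x y = ∑ i, o.volumeForm ![x, y, tangentONB M p i] • tangentONB M p i := by
  refine Fintype.sum_equiv (finCongr (Fact.out : finrank ℝ (TangentSpace (𝓡 3) p) = 3)) _ _
    fun i ↦ ?_
  simp [tangentONB]

theorem hodgeStar_eq_sum {p : M} (o : Orientation ℝ (TangentSpace (𝓡 3) p) (Fin 3))
    {W : Type*} [AddCommGroup W] [Module ℝ W]
    (α : TangentSpace (𝓡 3) p → TangentSpace (𝓡 3) p → W) (v : TangentSpace (𝓡 3) p) :
    hodgeStar o α v = (1 / 2 : ℝ) • ∑ i, ∑ j,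
      o.volumeForm ![tangentONB M p i, tangentONB M p j, v] •
        α (tangentONB M p i) (tangentONB M p j) := by
  unfold hodgeStar
  congr 1
  refine Fintype.sum_equiv (finCongr (Fact.out : finrank ℝ (TangentSpace (𝓡 3) p) = 3)) _ _
    fun i ↦ Fintype.sum_equiv (finCongr (Fact.out : finrank ℝ (TangentSpace (𝓡 3) p) = 3)) _ _
    fun j ↦ ?_
  simp [tangentONB]

theorem repr_transverseJ {p : M} (o : Orientation ℝ (TangentSpace (𝓡 3) p) (Fin 3))
    (x y : TangentSpace (𝓡 3) p) (i : Fin 3) :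
    (tangentONB M p).repr (transverseJ o x y) i = o.volumeForm ![x, y, tangentONB M p i] := by
  rw [transverseJ_eq_sum, map_sum]
  simp [OrthonormalBasis.repr_self, Pi.single_apply]

/-- The sign `ε` records whether the standard orthonormal basis is positively oriented. The same `ε`
occurs in the volume form and in the cross product, so expressions using two of these depend only on
`ε * ε = 1`. -/
theorem exists_repr_transverseJ {p : M} (o : Orientation ℝ (TangentSpace (𝓡 3) p) (Fin 3)) :
    ∃ ε : ℝ, ε * ε = 1 ∧
      (∀ x y z : TangentSpace (𝓡 3) p, o.volumeForm ![x, y, z] =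
        ε * Matrix.det (Matrix.of fun i j ↦ (tangentONB M p).repr (![x, y, z] j) i)) ∧
      ∀ x y : TangentSpace (𝓡 3) p,
      letI r := (tangentONB M p).repr
      r (transverseJ o x y) 0 = ε * (r x 1 * r y 2 - r x 2 * r y 1) ∧
      r (transverseJ o x y) 1 = ε * (r x 2 * r y 0 - r x 0 * r y 2) ∧
      r (transverseJ o x y) 2 = ε * (r x 0 * r y 1 - r x 1 * r y 0) := by
  obtain ⟨ε, hε, h⟩ := exists_volumeForm_eq o
  refine ⟨ε, hε, h, fun x y ↦ ?_⟩
  simp only [repr_transverseJ, h, Matrix.det_fin_three]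
  simp [OrthonormalBasis.repr_self]
  refine ⟨?_, ?_, ?_⟩ <;> left <;> ring

theorem inner_eq_repr {p : M} (x y : TangentSpace (𝓡 3) p) :
    letI r := (tangentONB M p).repr
    inner ℝ x y = r x 0 * r y 0 + r x 1 * r y 1 + r x 2 * r y 2 := by
  rw [← (tangentONB M p).repr.inner_map_map x y, PiLp.inner_apply, Fin.sum_univ_three]
  simp only [RCLike.inner_apply, conj_trivial, mul_comm]

theorem tangent_ext_repr {p : M} {x y : TangentSpace (𝓡 3) p}
    (h0 : (tangentONB M p).repr x 0 = (tangentONB M p).repr y 0)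
    (h1 : (tangentONB M p).repr x 1 = (tangentONB M p).repr y 1)
    (h2 : (tangentONB M p).repr x 2 = (tangentONB M p).repr y 2) : x = y := by
  apply (tangentONB M p).repr.injective
  ext i
  fin_cases i
  exacts [h0, h1, h2]

theorem transverseJ_transverseJ {p : M} (o : Orientation ℝ (TangentSpace (𝓡 3) p) (Fin 3))
    (x y z : TangentSpace (𝓡 3) p) :
    transverseJ o x (transverseJ o y z) = inner ℝ x z • y - inner ℝ x y • z := by
  obtain ⟨ε, hε, -, h⟩ := exists_repr_transverseJ o
  obtain ⟨h0, h1, h2⟩ := h x (transverseJ o y z)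
  obtain ⟨k0, k1, k2⟩ := h y z
  rw [inner_eq_repr, inner_eq_repr]
  apply tangent_ext_repr
  · rw [h0, k1, k2]
    simp only [map_sub, map_smul, PiLp.sub_apply, PiLp.smul_apply, smul_eq_mul]
    generalize (tangentONB M p).repr x = x, (tangentONB M p).repr y = y,
      (tangentONB M p).repr z = z
    linear_combination (x 1 * (y 0 * z 1 - y 1 * z 0) - x 2 * (y 2 * z 0 - y 0 * z 2)) * hε
  · rw [h1, k0, k2]
    simp only [map_sub, map_smul, PiLp.sub_apply, PiLp.smul_apply, smul_eq_mul]
    generalize (tangentONB M p).repr x = x, (tangentONB M p).repr y = y,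
      (tangentONB M p).repr z = z
    linear_combination (x 2 * (y 1 * z 2 - y 2 * z 1) - x 0 * (y 0 * z 1 - y 1 * z 0)) * hε
  · rw [h2, k0, k1]
    simp only [map_sub, map_smul, PiLp.sub_apply, PiLp.smul_apply, smul_eq_mul]
    generalize (tangentONB M p).repr x = x, (tangentONB M p).repr y = y,
      (tangentONB M p).repr z = z
    linear_combination (x 0 * (y 2 * z 0 - y 0 * z 2) - x 1 * (y 1 * z 2 - y 2 * z 1)) * hε

theorem transverseJ_swap {p : M} (o : Orientation ℝ (TangentSpace (𝓡 3) p) (Fin 3))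
    (x y : TangentSpace (𝓡 3) p) : transverseJ o x y = -transverseJ o y x := by
  obtain ⟨ε, hε, -, h⟩ := exists_repr_transverseJ o
  obtain ⟨h0, h1, h2⟩ := h x y
  obtain ⟨k0, k1, k2⟩ := h y x
  apply tangent_ext_repr <;> simp only [map_neg, PiLp.neg_apply, *] <;> ring

theorem transverseJ_add_smul {p : M} (o : Orientation ℝ (TangentSpace (𝓡 3) p) (Fin 3))
    (x y z : TangentSpace (𝓡 3) p) (a b : ℝ) :
    transverseJ o x (a • y + b • z) = a • transverseJ o x y + b • transverseJ o x z := by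
  obtain ⟨ε, hε, -, h⟩ := exists_repr_transverseJ o
  obtain ⟨h0, h1, h2⟩ := h x (a • y + b • z)
  obtain ⟨k0, k1, k2⟩ := h x y
  obtain ⟨l0, l1, l2⟩ := h x z
  apply tangent_ext_repr <;>
    simp only [map_add, map_smul, PiLp.add_apply, PiLp.smul_apply, smul_eq_mul, *] <;> ring

theorem inner_transverseJ_self {p : M} (o : Orientation ℝ (TangentSpace (𝓡 3) p) (Fin 3))
    (x y : TangentSpace (𝓡 3) p) : inner ℝ x (transverseJ o x y) = 0 := by
  obtain ⟨ε, hε, -, h⟩ := exists_repr_transverseJ o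
  obtain ⟨h0, h1, h2⟩ := h x y
  rw [inner_eq_repr, h0, h1, h2]
  ring

theorem tangent_eq_sum {p : M} (x : TangentSpace (𝓡 3) p) :
    letI r := (tangentONB M p).repr
    x = r x 0 • tangentONB M p 0 + r x 1 • tangentONB M p 1 + r x 2 • tangentONB M p 2 := by
  rw [← Fin.sum_univ_three (fun i ↦ (tangentONB M p).repr x i • tangentONB M p i),
    (tangentONB M p).sum_repr]

/-- In three dimensions, an alternating two-form `α` is recovered from its Hodge star:
`α(x, y) = (⋆ α)(x × y)`. -/
theorem hodgeStar_transverseJ {p : M} (o : Orientation ℝ (TangentSpace (𝓡 3) p) (Fin 3))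
    {W : Type*} [AddCommGroup W] [Module ℝ W]
    (α : TangentSpace (𝓡 3) p → TangentSpace (𝓡 3) p → W)
    (hα : ∀ x y z (a b : ℝ), α x (a • y + b • z) = a • α x y + b • α x z)
    (hα' : ∀ x y, α x y = -α y x) (x y : TangentSpace (𝓡 3) p) :
    hodgeStar o α (transverseJ o x y) = α x y := by
  have hs (x : TangentSpace (𝓡 3) p) : α x x = 0 := by
    have h : (2 : ℝ) • α x x = 0 := by
      rw [two_smul]; nth_rewrite 1 [hα' x x]; exact neg_add_cancel _
    simpa using h
  have hl (x y z) (a b : ℝ) : α (a • y + b • z) x = a • α y x + b • α z x := by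
    rw [hα', hα, hα' y, hα' z]; module
  obtain ⟨ε, hε, hv, h⟩ := exists_repr_transverseJ o
  obtain ⟨h0, h1, h2⟩ := h x y
  -- The coefficient `1` gives the three-term sum the shape `a • y + b • z`, nested twice, to which
  -- `hα` and `hl` apply.
  have e3 (x : TangentSpace (𝓡 3) p) :
    letI r := (tangentONB M p).repr
    x = (1 : ℝ) • (r x 0 • tangentONB M p 0 + r x 1 • tangentONB M p 1)
      + r x 2 • tangentONB M p 2 := by
    rw [one_smul]; exact tangent_eq_sum x
  have hxy : α x y =
      letI r := (tangentONB M p).repr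
      (r x 1 * r y 2 - r x 2 * r y 1) • α (tangentONB M p 1) (tangentONB M p 2)
      + (r x 2 * r y 0 - r x 0 * r y 2) • α (tangentONB M p 2) (tangentONB M p 0)
      + (r x 0 * r y 1 - r x 1 * r y 0) • α (tangentONB M p 0) (tangentONB M p 1) := by
    conv_lhs => rw [e3 x, e3 y]
    simp only [hα, hl, hs]
    rw [hα' (tangentONB M p 1) (tangentONB M p 0), hα' (tangentONB M p 0) (tangentONB M p 2),
      hα' (tangentONB M p 2) (tangentONB M p 1)]
    module
  rw [hodgeStar_eq_sum, hxy]
  simp only [Fin.sum_univ_three, hs, hv, Matrix.det_fin_three]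
  simp only [Matrix.of_apply, Matrix.cons_val_zero, Matrix.cons_val_one, Matrix.cons_val,
    h0, h1, h2, OrthonormalBasis.repr_self]
  rw [hα' (tangentONB M p 1) (tangentONB M p 0), hα' (tangentONB M p 0) (tangentONB M p 2),
      hα' (tangentONB M p 2) (tangentONB M p 1)]
  simp
  generalize (tangentONB M p).repr x = x, (tangentONB M p).repr y = y
  match_scalars
  · linear_combination (x 0 * y 1 - x 1 * y 0) * hε
  · linear_combination (x 2 * y 0 - x 0 * y 2) * hε
  · linear_combination (x 1 * y 2 - x 2 * y 1) * hε

end Cross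

/-! ### Locality and linearity of the connection and its curvature -/

section Connection

variable {M : Type*} [TopologicalSpace M] [ChartedSpace (EuclideanSpace ℝ (Fin 3)) M]
  [IsManifold (𝓡 3) ∞ M]
  {F : Type*} [NormedAddCommGroup F] [NormedSpace ℂ F]
  {E : M → Type*} [TopologicalSpace (TotalSpace F E)]
  [∀ p, AddCommGroup (E p)] [∀ p, Module ℂ (E p)] [∀ p, TopologicalSpace (E p)]
  [∀ p, IsTopologicalAddGroup (E p)] [∀ p, ContinuousSMul ℝ (E p)]
  [FiberBundle F E] [VectorBundle ℝ F E]

/-- Smoothness of `D` concerns globally smooth sections, while extensions are smooth only near `p`.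
A bump function supported in the smooth region makes the section global without changing its germ at
`p`. -/
theorem mdifferentiableAt_apply_covariantDerivative [T2Space M]
    (D : CovariantDerivative (𝓡 3) F E) (hD : D.ContMDiffCovariantDerivative ∞)
    {s : Π p : M, E p} {X : Π p : M, TangentSpace (𝓡 3) p} {p : M} {u : Set M} (hu : u ∈ 𝓝 p)
    (hs : ContMDiffOn (𝓡 3) ((𝓡 3).prod 𝓘(ℝ, F)) ∞ (fun q ↦ TotalSpace.mk' F q (s q)) u)
    (hX : MDifferentiableAt (𝓡 3) (𝓡 3).tangent
      (fun q ↦ (⟨q, X q⟩ : TangentBundle (𝓡 3) M)) p) :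
    MDifferentiableAt (𝓡 3) ((𝓡 3).prod 𝓘(ℝ, F))
      (fun q ↦ TotalSpace.mk' F q (D s q (X q))) p := by
  obtain ⟨v, hvu, hvo, hpv⟩ := mem_nhds_iff.1 hu
  obtain ⟨f, -, hf⟩ := (SmoothBumpFunction.nhds_basis_tsupport (I := 𝓡 3) p).mem_iff.1
    (hvo.mem_nhds hpv)
  have hfs : ContMDiff (𝓡 3) ((𝓡 3).prod 𝓘(ℝ, F)) ∞
      (fun q ↦ TotalSpace.mk' F q (f q • s q)) :=
    ContMDiffOn.smul_section_of_tsupport (f.contMDiff.contMDiffOn) hvo hf (hs.mono hvu)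
  have hDf := (hD.contMDiff.contMDiff (σ := fun q ↦ f q • s q)
    (by simpa using hfs.contMDiffOn)).contMDiffAt (x := p) Filter.univ_mem
  have h := (hDf.mdifferentiableAt (by simp)).clm_bundle_apply hX
  refine h.congr_of_eventuallyEq ?_
  -- The bump function must be 1 in a neighbourhood of each nearby `q`, since `D s q` depends on the
  -- germ of `s` at `q`.
  filter_upwards [f.eventuallyEq_one.eventuallyEq_nhds, hvo.mem_nhds hpv] with q hq hqv
  congr 2
  refine D.isCovariantDerivativeOnUniv.congr_of_eventuallyEq ?_
    (hfs.contMDiffAt.mdifferentiableAt (by simp)) Filter.univ_mem ?_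
  · exact ((hs.mono hvu).contMDiffAt (hvo.mem_nhds hqv)).mdifferentiableAt (by simp)
  · filter_upwards [hq] with y hy
    simp [hy]


theorem mdifferentiableAt_tangent_extend {p : M} (v : TangentSpace (𝓡 3) p) :
    MDifferentiableAt (𝓡 3) (𝓡 3).tangent (fun q ↦
      (⟨q, FiberBundle.extend (EuclideanSpace ℝ (Fin 3)) v q⟩ : TangentBundle (𝓡 3) M)) p :=
  FiberBundle.mdifferentiableAt_extend (𝓡 3) (EuclideanSpace ℝ (Fin 3)) v

omit [IsManifold (𝓡 3) ∞ M] in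
theorem mdifferentiableAt_end_apply {φ : Π p : M, E p →L[ℂ] E p} {U : Set M}
    (hφ : SmoothEndOn (𝓡 3) F φ U) {s : Π p : M, E p} {p : M} (hU : U ∈ 𝓝 p)
    (hs : MDifferentiableAt (𝓡 3) ((𝓡 3).prod 𝓘(ℝ, F)) (fun q ↦ TotalSpace.mk' F q (s q)) p) :
    MDifferentiableAt (𝓡 3) ((𝓡 3).prod 𝓘(ℝ, F))
      (fun q ↦ TotalSpace.mk' F q (φ q (s q))) p :=
  ((hφ.contMDiffAt hU).mdifferentiableAt (by simp)).clm_bundle_apply hs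

omit [VectorBundle ℝ F E] in
theorem curvature_eq (D : CovariantDerivative (𝓡 3) F E) (p : M) (X Y : TangentSpace (𝓡 3) p)
    (e : E p) :
    curvature F D p X Y e =
      D (fun q ↦ D (FiberBundle.extend F e) q
        (FiberBundle.extend (EuclideanSpace ℝ (Fin 3)) Y q)) p X
      - D (fun q ↦ D (FiberBundle.extend F e) q
        (FiberBundle.extend (EuclideanSpace ℝ (Fin 3)) X q)) p Y := by
  rw [curvature, mlieBracket_extend, map_zero, sub_zero]

omit [VectorBundle ℝ F E] in
theorem curvature_swap (D : CovariantDerivative (𝓡 3) F E) (p : M) (X Y : TangentSpace (𝓡 3) p)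
    (e : E p) : curvature F D p X Y e = -curvature F D p Y X e := by
  rw [curvature_eq, curvature_eq, neg_sub]

variable [ContMDiffVectorBundle ∞ F E (𝓡 3)]

theorem mdifferentiableAt_apply_extend [T2Space M]
    (D : CovariantDerivative (𝓡 3) F E) (hD : D.ContMDiffCovariantDerivative ∞)
    {p : M} (e : E p) (v : TangentSpace (𝓡 3) p) :
    MDifferentiableAt (𝓡 3) ((𝓡 3).prod 𝓘(ℝ, F))
      (fun q ↦ TotalSpace.mk' F q (D (FiberBundle.extend F e) q
        (FiberBundle.extend (EuclideanSpace ℝ (Fin 3)) v q))) p := by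
  obtain ⟨u, hu, hs⟩ := FiberBundle.exists_contMDiffOn_extend (k := ∞) (𝓡 3) F e
  exact mdifferentiableAt_apply_covariantDerivative D hD hu hs (mdifferentiableAt_tangent_extend v)

omit [IsManifold (𝓡 3) ∞ M] [∀ p, IsTopologicalAddGroup (E p)] [∀ p, ContinuousSMul ℝ (E p)]
  [VectorBundle ℝ F E] [ContMDiffVectorBundle ∞ F E (𝓡 3)] in
theorem mdifferentiableAt_bundle_extend {p : M} (e : E p) :
    MDifferentiableAt (𝓡 3) ((𝓡 3).prod 𝓘(ℝ, F))
      (fun q ↦ TotalSpace.mk' F q (FiberBundle.extend F e q)) p :=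
  (FiberBundle.contMDiffAt_extend (k := ∞) (𝓡 3) F e).mdifferentiableAt (by simp)

omit [IsManifold (𝓡 3) ∞ M] [ContMDiffVectorBundle ∞ F E (𝓡 3)] in
theorem covariantDerivative_add_smul_of_eventuallyEq (D : CovariantDerivative (𝓡 3) F E)
    {s s₁ s₂ : Π p : M, E p} {p : M} (a b : ℝ)
    (h₁ : MDifferentiableAt (𝓡 3) ((𝓡 3).prod 𝓘(ℝ, F)) (fun q ↦ TotalSpace.mk' F q (s₁ q)) p)
    (h₂ : MDifferentiableAt (𝓡 3) ((𝓡 3).prod 𝓘(ℝ, F)) (fun q ↦ TotalSpace.mk' F q (s₂ q)) p)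
    (h : ∀ᶠ q in 𝓝 p, s q = a • s₁ q + b • s₂ q) :
    D s p = a • D s₁ p + b • D s₂ p := by
  have k₁ : MDifferentiableAt (𝓡 3) ((𝓡 3).prod 𝓘(ℝ, F))
      (fun q ↦ TotalSpace.mk' F q ((a • s₁) q)) p :=
    (mdifferentiableAt_const (c := a)).smul_section h₁
  have k₂ : MDifferentiableAt (𝓡 3) ((𝓡 3).prod 𝓘(ℝ, F))
      (fun q ↦ TotalSpace.mk' F q ((b • s₂) q)) p :=
    (mdifferentiableAt_const (c := b)).smul_section h₂
  have k := mdifferentiableAt_add_section k₁ k₂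
  rw [D.isCovariantDerivativeOnUniv.congr_of_eventuallyEq (σ' := a • s₁ + b • s₂) ?_ k
    Filter.univ_mem h, D.isCovariantDerivativeOnUniv.add k₁ k₂,
    D.isCovariantDerivativeOnUniv.smul_const a h₁, D.isCovariantDerivativeOnUniv.smul_const b h₂]
  refine k.congr_of_eventuallyEq ?_
  filter_upwards [h] with q hq
  rw [hq]
  rfl

/-- The extension of a vector depends linearly on it near `p`, and `D` sees only germs; no
tensoriality argument is needed. -/
theorem curvature_add_smul_right [T2Space M]
    (D : CovariantDerivative (𝓡 3) F E) (hD : D.ContMDiffCovariantDerivative ∞)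
    {p : M} (X Y Z : TangentSpace (𝓡 3) p) (a b : ℝ) (e : E p) :
    curvature F D p X (a • Y + b • Z) e
      = a • curvature F D p X Y e + b • curvature F D p X Z e := by
  simp only [curvature_eq]
  rw [covariantDerivative_add_smul_of_eventuallyEq D a b
    (mdifferentiableAt_apply_extend D hD e Y) (mdifferentiableAt_apply_extend D hD e Z)]
  · simp only [map_add, map_smul, _root_.add_apply, _root_.smul_apply]
    module
  · filter_upwards [eventually_extend_add_smul (EuclideanSpace ℝ (Fin 3)) a b Y Z] with q hq
    rw [hq, map_add, map_smul, map_smul]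

omit [IsManifold (𝓡 3) ∞ M] [NormedSpace ℂ F]
  [∀ p, IsTopologicalAddGroup (E p)] [∀ p, ContinuousSMul ℝ (E p)]
  [VectorBundle ℝ F E] [ContMDiffVectorBundle ∞ F E (𝓡 3)] in
theorem endDeriv_add_smul (D : (Π p : M, E p) → (Π p : M, TangentSpace (𝓡 3) p →L[ℝ] E p))
    (ψ : Π p : M, E p →L[ℂ] E p) (p : M) (v w : TangentSpace (𝓡 3) p) (a b : ℝ) (e : E p) :
    endDeriv F D ψ p (a • v + b • w) e = a • endDeriv F D ψ p v e + b • endDeriv F D ψ p w e := by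
  simp only [endDeriv, map_add, map_smul, (ψ p).map_smul_of_tower]
  module

theorem endDeriv_neg_two_I_smul [∀ p, ContinuousSMul ℂ (E p)] (D : CovariantDerivative (𝓡 3) F E)
    (hD : ∀ (s : Π p : M, E p) (p : M) (v : TangentSpace (𝓡 3) p),
      MDifferentiableAt (𝓡 3) ((𝓡 3).prod 𝓘(ℝ, F)) (fun q ↦ TotalSpace.mk' F q (s q)) p →
      D (fun q ↦ Complex.I • s q) p v = Complex.I • D s p v)
    {φ : Π p : M, E p →L[ℂ] E p} (hφ : SmoothEndOn (𝓡 3) F φ Set.univ)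
    (p : M) (v : TangentSpace (𝓡 3) p) (e : E p) :
    endDeriv F D (fun q ↦ (-2 * Complex.I) • φ q) p v e
      = (-2 * Complex.I) • endDeriv F D φ p v e := by
  set s := FiberBundle.extend F e with hs
  have h₁ := mdifferentiableAt_end_apply hφ Filter.univ_mem
    (mdifferentiableAt_bundle_extend (F := F) e)
  have h₂ : MDifferentiableAt (𝓡 3) ((𝓡 3).prod 𝓘(ℝ, F))
      (fun q ↦ TotalSpace.mk' F q (((-2 : ℝ) • fun q ↦ φ q (s q)) q)) p :=
    (mdifferentiableAt_const (c := (-2 : ℝ))).smul_section h₁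
  have key : D (fun q ↦ ((-2 * Complex.I) • φ q) (s q)) p v
      = (-2 * Complex.I) • D (fun q ↦ φ q (s q)) p v := by
    -- The factor -2i is split into the real scalar -2, handled by real linearity of `D`, and
    -- `Complex.I`, handled by `hD`.
    have h₃ : (fun q ↦ ((-2 * Complex.I) • φ q) (s q))
        = fun q ↦ Complex.I • ((-2 : ℝ) • fun q ↦ φ q (s q)) q := by
      ext q
      change (-2 * Complex.I) • φ q (s q) = Complex.I • (-2 : ℝ) • φ q (s q)
      module
    rw [h₃, hD _ _ _ h₂, D.isCovariantDerivativeOnUniv.smul_const (-2 : ℝ) h₁]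
    change Complex.I • (-2 : ℝ) • D (fun q ↦ φ q (s q)) p v = _
    module
  rw [endDeriv, key, endDeriv]
  change _ - (-2 * Complex.I) • φ p (D s p v) = _
  rw [smul_sub]

end Connection

/-! ### The connection on the cone and its curvature -/

section Cone

variable {M : Type*} [TopologicalSpace M] [ChartedSpace (EuclideanSpace ℝ (Fin 3)) M]
  [IsManifold (𝓡 3) ∞ M]
  {F : Type*} [NormedAddCommGroup F] [NormedSpace ℂ F]
  {E : M → Type*} [TopologicalSpace (TotalSpace F E)]
  [∀ p, AddCommGroup (E p)] [∀ p, Module ℂ (E p)] [∀ p, TopologicalSpace (E p)]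
  [∀ p, IsTopologicalAddGroup (E p)] [∀ p, ContinuousSMul ℝ (E p)]
  [FiberBundle F E] [VectorBundle ℝ F E] [ContMDiffVectorBundle ∞ F E (𝓡 3)]

theorem deriv_const_of_topologicalSpace {W : Type*} [AddCommGroup W] [Module ℝ W]
    [TopologicalSpace W] [IsTopologicalAddGroup W] [ContinuousSMul ℝ W] (w : W) (t : ℝ) :
    deriv (fun _ : ℝ ↦ w) t = 0 := by
  rw [deriv, fderiv_const_apply]
  rfl

omit [IsManifold (𝓡 3) ∞ M] in
theorem coneConnection_coneVector
    (D : (Π p : M, E p) → (Π p : M, TangentSpace (𝓡 3) p →L[ℝ] E p))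
    (φ : Π p : M, E p →L[ℂ] E p) (c : ℝ) (S : Π x : M × ℝ, ConePullback E x) (x : M × ℝ)
    (v : TangentSpace (𝓡 3) x.1) (τ : ℝ) :
    coneConnection D φ c S x (coneVector x v τ)
      = (D (fun q ↦ (S (q, x.2) : E q)) x.1 v + τ • (deriv (fun t : ℝ ↦ (S (x.1, t) : E x.1)) x.2
        + (1 / (x.2 * √c)) • φ x.1 (S x)) : E x.1) :=
  rfl

/-- The section of the pull-back bundle defined by a section of `E`. -/
def pullbackSection (s : Π p : M, E p) (x : M × ℝ) : ConePullback E x := s x.1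

omit [IsManifold (𝓡 3) ∞ M] in
theorem coneConnection_pullbackSection
    (D : (Π p : M, E p) → (Π p : M, TangentSpace (𝓡 3) p →L[ℝ] E p))
    (φ : Π p : M, E p →L[ℂ] E p) (c : ℝ) (s : Π p : M, E p) (x : M × ℝ)
    (v : TangentSpace (𝓡 3) x.1) (τ : ℝ) :
    coneConnection D φ c (pullbackSection s) x (coneVector x v τ)
      = (D s x.1 v + (τ / (x.2 * √c)) • φ x.1 (s x.1) : E x.1) := by
  rw [coneConnection_coneVector]
  change D s x.1 v + τ • (deriv (fun _ : ℝ ↦ s x.1) x.2 + (1 / (x.2 * √c)) • φ x.1 (s x.1)) = _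
  rw [deriv_const_of_topologicalSpace, zero_add, smul_smul, mul_one_div]

omit [IsManifold (𝓡 3) ∞ M] [∀ p, IsTopologicalAddGroup (E p)] [∀ p, ContinuousSMul ℝ (E p)]
  [VectorBundle ℝ F E] [ContMDiffVectorBundle ∞ F E (𝓡 3)] in
theorem extend_conePullback_eq_pullbackSection {x : M × ℝ} (e : E x.1) :
    FiberBundle.extend F (E := ConePullback E) (x := x) e
      = pullbackSection (FiberBundle.extend F e) := by
  ext y
  exact extend_conePullback F (x := x) e y

omit [IsManifold (𝓡 3) ∞ M] [VectorBundle ℝ F E] [ContMDiffVectorBundle ∞ F E (𝓡 3)] in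
theorem endDeriv_coneConnection
    (D : (Π p : M, E p) → (Π p : M, TangentSpace (𝓡 3) p →L[ℝ] E p))
    (φ ψ : Π p : M, E p →L[ℂ] E p) (c : ℝ) (x : M × ℝ)
    (v : TangentSpace (𝓡 3) x.1) (τ : ℝ) (e : E x.1) :
    endDeriv F (coneConnection D φ c) (pullbackEnd ψ) x (coneVector x v τ) e
      = (endDeriv F D ψ x.1 v e
        + (τ / (x.2 * √c)) • (φ x.1 (ψ x.1 e) - ψ x.1 (φ x.1 e)) : E x.1) := by
  have h : endDeriv F (coneConnection D φ c) (pullbackEnd ψ) x (coneVector x v τ) e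
      = coneConnection D φ c (pullbackSection fun q ↦ ψ q (FiberBundle.extend F e q)) x
          (coneVector x v τ)
        - pullbackEnd ψ x (coneConnection D φ c (pullbackSection (FiberBundle.extend F e)) x
          (coneVector x v τ)) := by
    rw [← extend_conePullback_eq_pullbackSection]
    exact congrArg (fun S : Π x : M × ℝ, ConePullback E x ↦
      coneConnection D φ c (fun y ↦ pullbackEnd ψ y (S y)) x (coneVector x v τ) - _)
      (extend_conePullback_eq_pullbackSection e)
  rw [coneConnection_pullbackSection, coneConnection_pullbackSection] at h
  refine h.trans ?_
  change _ - ψ x.1 (D (FiberBundle.extend F e) x.1 v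
    + (τ / (x.2 * √c)) • φ x.1 (FiberBundle.extend F e x.1)) = _
  rw [map_add, (ψ x.1).map_smul_of_tower, FiberBundle.extend_apply_self, endDeriv]
  module

/-- With a t-independent extension of `e` and vanishing bracket, the φ-terms combine into ∇_v(φ s) -
φ ∇_v s. A first argument without ∂_t-component suffices, since Z has none. -/
theorem curvature_coneConnection [T2Space M]
    (D : CovariantDerivative (𝓡 3) F E) (hD : D.ContMDiffCovariantDerivative ∞)
    {φ : Π p : M, E p →L[ℂ] E p} (hφ : SmoothEndOn (𝓡 3) F φ Set.univ) (c : ℝ) (x : M × ℝ)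
    (v u : TangentSpace (𝓡 3) x.1) (τ : ℝ) (e : E x.1) :
    curvature F (coneConnection D φ c) x (coneVector x v 0) (coneVector x u τ) e
      = (curvature F D x.1 v u e + (τ / (x.2 * √c)) • endDeriv F D φ x.1 v e : E x.1) := by
  have hsrc : (chartAt (EuclideanSpace ℝ (Fin 3)) x.1).source ∈ 𝓝 x.1 :=
    (chartAt (EuclideanSpace ℝ (Fin 3)) x.1).open_source.mem_nhds (mem_chart_source _ _)
  set s := FiberBundle.extend F e with hs
  have hbr : VectorField.mlieBracket ((𝓡 3).prod 𝓘(ℝ, ℝ))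
      (FiberBundle.extend (EuclideanSpace ℝ (Fin 3) × ℝ) (coneVector x v 0))
      (FiberBundle.extend (EuclideanSpace ℝ (Fin 3) × ℝ) (coneVector x u τ)) x = 0 :=
    mlieBracket_extend _ _
  have hc : curvature F (coneConnection D φ c) x (coneVector x v 0) (coneVector x u τ) e
      = coneConnection D φ c (fun y ↦ coneConnection D φ c (pullbackSection s) y
          (FiberBundle.extend (EuclideanSpace ℝ (Fin 3) × ℝ) (coneVector x u τ) y)) x
          (coneVector x v 0)
        - coneConnection D φ c (fun y ↦ coneConnection D φ c (pullbackSection s) y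
          (FiberBundle.extend (EuclideanSpace ℝ (Fin 3) × ℝ) (coneVector x v 0) y)) x
          (coneVector x u τ) := by
    rw [hs, ← extend_conePullback_eq_pullbackSection]
    unfold curvature
    rw [hbr, map_zero, sub_zero]
  have key (w : TangentSpace (𝓡 3) x.1) (ρ : ℝ) (y : M × ℝ)
      (hy : y.1 ∈ (chartAt (EuclideanSpace ℝ (Fin 3)) x.1).source) :
      coneConnection D φ c (pullbackSection s) y
        (FiberBundle.extend (EuclideanSpace ℝ (Fin 3) × ℝ) (coneVector x w ρ) y)
      = (D s y.1 (FiberBundle.extend (EuclideanSpace ℝ (Fin 3)) w y.1)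
          + (ρ / (y.2 * √c)) • φ y.1 (s y.1) : E y.1) := by
    rw [extend_coneVector hy, coneConnection_pullbackSection]
  have kv : D (fun q ↦ coneConnection D φ c (pullbackSection s) (q, x.2)
        (FiberBundle.extend (EuclideanSpace ℝ (Fin 3) × ℝ) (coneVector x v 0) (q, x.2))) x.1
      = D (fun q ↦ D s q (FiberBundle.extend (EuclideanSpace ℝ (Fin 3)) v q)) x.1 := by
    -- The coefficients 1 and 0 make the linearity lemma serve as a congruence for germs; the second
    -- section is a dummy.
    have := covariantDerivative_add_smul_of_eventuallyEq D 1 0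
      (mdifferentiableAt_apply_extend D hD e v)
      (mdifferentiableAt_apply_extend D hD e v)
      (s := fun q ↦ coneConnection D φ c (pullbackSection s) (q, x.2)
        (FiberBundle.extend (EuclideanSpace ℝ (Fin 3) × ℝ) (coneVector x v 0) (q, x.2))) (by
        filter_upwards [hsrc] with q hq
        rw [key v 0 (q, x.2) hq]
        simp [hs])
    rw [this, one_smul, zero_smul, add_zero]
  have ku : D (fun q ↦ coneConnection D φ c (pullbackSection s) (q, x.2)
        (FiberBundle.extend (EuclideanSpace ℝ (Fin 3) × ℝ) (coneVector x u τ) (q, x.2))) x.1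
      = D (fun q ↦ D s q (FiberBundle.extend (EuclideanSpace ℝ (Fin 3)) u q)) x.1
        + (τ / (x.2 * √c)) • D (fun q ↦ φ q (s q)) x.1 := by
    have := covariantDerivative_add_smul_of_eventuallyEq D 1 (τ / (x.2 * √c))
      (mdifferentiableAt_apply_extend D hD e u)
      (mdifferentiableAt_end_apply hφ Filter.univ_mem
        (mdifferentiableAt_bundle_extend (F := F) e))
      (s := fun q ↦ coneConnection D φ c (pullbackSection s) (q, x.2)
        (FiberBundle.extend (EuclideanSpace ℝ (Fin 3) × ℝ) (coneVector x u τ) (q, x.2))) (by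
        filter_upwards [hsrc] with q hq
        rw [key u τ (q, x.2) hq]
        simp [hs])
    rw [this, one_smul]
  have kd : (fun t : ℝ ↦ (coneConnection D φ c (pullbackSection s) (x.1, t)
        (FiberBundle.extend (EuclideanSpace ℝ (Fin 3) × ℝ) (coneVector x v 0) (x.1, t)) : E x.1))
      = fun _ ↦ D s x.1 v := by
    ext t
    rw [key v 0 (x.1, t) (mem_chart_source _ _)]
    change D s x.1 (FiberBundle.extend (EuclideanSpace ℝ (Fin 3)) v x.1)
      + (0 / (t * √c)) • φ x.1 (s x.1) = _
    rw [FiberBundle.extend_apply_self, zero_div, zero_smul, add_zero]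
  have kx : coneConnection D φ c (pullbackSection s) x
        (FiberBundle.extend (EuclideanSpace ℝ (Fin 3) × ℝ) (coneVector x v 0) x)
      = (D s x.1 v : E x.1) := congrFun kd x.2
  rw [coneConnection_coneVector, coneConnection_coneVector, kv, ku, kd, kx,
    deriv_const_of_topologicalSpace, zero_add] at hc
  refine hc.trans ?_
  rw [curvature_eq, endDeriv, ← hs]
  change (D _ x.1 v + (τ / (x.2 * √c)) • D (fun q ↦ φ q (s q)) x.1 v + _) - _ = _
  rw [zero_smul, smul_smul, mul_one_div]
  module

end Cone

/-! ### The frame (s, x × s, x) -/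

section Frame

variable {M : Type*} [TopologicalSpace M] [ChartedSpace (EuclideanSpace ℝ (Fin 3)) M]
  [RiemannianBundle (fun p : M ↦ TangentSpace (𝓡 3) p)]

theorem transverseJ_self {p : M} (o : Orientation ℝ (TangentSpace (𝓡 3) p) (Fin 3))
    (x : TangentSpace (𝓡 3) p) : transverseJ o x x = 0 := by
  obtain ⟨ε, hε, -, h⟩ := exists_repr_transverseJ o
  obtain ⟨h0, h1, h2⟩ := h x x
  apply tangent_ext_repr <;> simp only [map_zero, PiLp.zero_apply, *] <;> ring

variable {p : M} (o : Orientation ℝ (TangentSpace (𝓡 3) p) (Fin 3))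
  {x s : TangentSpace (𝓡 3) p}

theorem transverseJ_transverseJ_of_orthonormal (hx : ‖x‖ = 1) (hsx : inner ℝ s x = 0) :
    transverseJ o x (transverseJ o x s) = -s := by
  rw [transverseJ_transverseJ, real_inner_comm, hsx, real_inner_self_eq_norm_sq, hx]
  simp

theorem transverseJ_apply_transverseJ_of_orthonormal (hs : ‖s‖ = 1) (hsx : inner ℝ s x = 0) :
    transverseJ o s (transverseJ o x s) = x := by
  rw [transverseJ_transverseJ, hsx, real_inner_self_eq_norm_sq, hs]
  simp

/-- `(s, x × s, x)` spans the tangent space. -/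
theorem exists_eq_frame_combination (hx : ‖x‖ = 1) (hs : ‖s‖ = 1) (hsx : inner ℝ s x = 0)
    (v : TangentSpace (𝓡 3) p) :
    ∃ a b n : ℝ, v = (1 : ℝ) • (a • s + b • transverseJ o x s) + n • x := by
  -- The component of `v` orthogonal to `x` is (x × v) × x. Writing the last `x` as s × (x × s) and
  -- expanding the triple product gives its coefficients along `s` and x × s.
  have h1 := transverseJ_transverseJ o x x v
  have h2 := transverseJ_transverseJ o (transverseJ o x v) s (transverseJ o x s)
  rw [transverseJ_apply_transverseJ_of_orthonormal o hs hsx, transverseJ_swap, h1,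
    real_inner_self_eq_norm_sq, hx] at h2
  refine ⟨inner ℝ (transverseJ o x v) (transverseJ o x s), -inner ℝ (transverseJ o x v) s,
    inner ℝ x v, ?_⟩
  rw [neg_smul, ← sub_eq_add_neg, ← h2]
  module

theorem transverseJ_frame_combination (hx : ‖x‖ = 1) (hsx : inner ℝ s x = 0) (a b n : ℝ) :
    transverseJ o x ((1 : ℝ) • (a • s + b • transverseJ o x s) + n • x)
      = a • transverseJ o x s + (-b) • s := by
  rw [transverseJ_add_smul, transverseJ_add_smul, transverseJ_self,
    transverseJ_transverseJ_of_orthonormal o hx hsx]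
  module

theorem inner_frame_combination (hx : ‖x‖ = 1) (hsx : inner ℝ s x = 0) (a b n : ℝ) :
    inner ℝ x ((1 : ℝ) • (a • s + b • transverseJ o x s) + n • x) = n := by
  rw [real_inner_comm] at hsx
  simp only [inner_add_right, inner_smul_right, inner_transverseJ_self, hsx]
  rw [real_inner_self_eq_norm_sq, hx]
  ring

end Frame

/-! ### Comparison of the three systems -/

/-- Here `As`, `Aj`, `Ax` stand for the derivatives of ψ along σ, jσ, ξ, the letters `Bs`, `Bj`,
`Bx` for those of φ, `K` for [φ, ψ] and `r` for t√c. The factors a - i b and n + i τ / (2r) are the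
(0,1)-coordinates of w: replacing w by J w multiplies both by -i. -/
theorem cauchyRiemann_residual_identity {W : Type*} [AddCommGroup W] [Module ℂ W]
    (As Aj Ax Bs Bj Bx K : W) (a b n τ r : ℝ) (hr : r ≠ 0) :
    (((1 : ℝ) • (a • As + b • Aj) + n • Ax) + (τ / r) • K
      + Complex.I • (((1 : ℝ) • (a • Aj + (-b) • As) + (τ / (2 * r)) • Ax)
          + ((-(2 * r) * n) / r) • K))
      - ((((1 : ℝ) • (b • (2 : ℝ) • Bx) + n • (-2 : ℝ) • Bj) + (τ / r) • Bs)
        + Complex.I • (((1 : ℝ) • (a • (2 : ℝ) • Bx) + n • (-2 : ℝ) • Bs) + (τ / r) • -Bj))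
      = (a - b * Complex.I) • (As + Complex.I • Aj - (2 * Complex.I) • Bx)
        + (n + (τ / (2 * r) : ℝ) * Complex.I) • (Ax - (2 * Complex.I) • K
          - (-2 * Complex.I) • (Bs + Complex.I • -Bj)) := by
  have hr' : (r : ℂ) ≠ 0 := by exact_mod_cast hr
  match_scalars <;> simp only [Complex.coe_algebraMap] <;> ring_nf <;>
    try simp only [Complex.I_sq, Complex.I_pow_three]
  all_goals first | ring1 | field_simp

theorem endDeriv_hatConnection {M : Type*} [TopologicalSpace M]
    [ChartedSpace (EuclideanSpace ℝ (Fin 3)) M]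
    [RiemannianBundle (fun p : M ↦ TangentSpace (𝓡 3) p)]
    {F : Type*} [NormedAddCommGroup F] [NormedSpace ℂ F]
    {E : M → Type*} [TopologicalSpace (TotalSpace F E)]
    [∀ p, AddCommGroup (E p)] [∀ p, Module ℂ (E p)] [∀ p, TopologicalSpace (E p)]
    [∀ p, IsTopologicalAddGroup (E p)] [∀ p, ContinuousSMul ℝ (E p)] [FiberBundle F E]
    (D : (Π p : M, E p) → (Π p : M, TangentSpace (𝓡 3) p →L[ℝ] E p))
    (ξ : Π p : M, TangentSpace (𝓡 3) p) (ϕ ψ : Π p : M, E p →L[ℂ] E p)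
    (p : M) (v : TangentSpace (𝓡 3) p) (e : E p) :
    endDeriv F (hatConnection D ξ ϕ) ψ p v e
      = endDeriv F D ψ p v e
        + (inner ℝ (ξ p) v : ℝ) • (ϕ p (ψ p e) - ψ p (ϕ p e)) := by
  simp only [endDeriv, hatConnection, _root_.add_apply, ContinuousLinearMap.smulRight_apply,
    innerSL_apply_apply, FiberBundle.extend_apply_self, map_add, (ψ p).map_smul_of_tower]
  module

theorem coneJ_coneVector {M : Type*} [TopologicalSpace M]
    [ChartedSpace (EuclideanSpace ℝ (Fin 3)) M]
    [RiemannianBundle (fun p : M ↦ TangentSpace (𝓡 3) p)]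
    (o : Π p : M, Orientation ℝ (TangentSpace (𝓡 3) p) (Fin 3))
    (ξ : Π p : M, TangentSpace (𝓡 3) p) (c : ℝ) (x : M × ℝ) (v : TangentSpace (𝓡 3) x.1) (τ : ℝ) :
    coneJ o ξ c x (coneVector x v τ)
      = coneVector x (transverseJ (o x.1) (ξ x.1) v + (τ / (2 * x.2 * √c)) • ξ x.1)
          (-(2 * x.2 * √c) * inner ℝ (ξ x.1) v) :=
  rfl

theorem proposition2
    {M : Type*} [TopologicalSpace M] [T2Space M] [ChartedSpace (EuclideanSpace ℝ (Fin 3)) M]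
    [IsManifold (𝓡 3) ∞ M]
    [RiemannianBundle (fun p : M ↦ TangentSpace (𝓡 3) p)]
    [IsContMDiffRiemannianBundle (𝓡 3) ∞ (EuclideanSpace ℝ (Fin 3))
      (fun p : M ↦ TangentSpace (𝓡 3) p)]
    (o : ManifoldOrientation M)
    (ξ : Π p : M, TangentSpace (𝓡 3) p)
    (hξ_smooth : ContMDiff (𝓡 3) (𝓡 3).tangent ∞ (fun p ↦ (⟨p, ξ p⟩ : TangentBundle (𝓡 3) M)))
    (hξ_unit : ∀ p, ‖ξ p‖ = 1)
    (c : ℝ) (hc : 0 < c)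
    -- a complex vector bundle `E` with a connection `∇`
    (F : Type*) [NormedAddCommGroup F] [NormedSpace ℂ F] [FiniteDimensional ℂ F]
    (E : M → Type*) [TopologicalSpace (TotalSpace F E)]
    [∀ p, AddCommGroup (E p)] [∀ p, Module ℂ (E p)] [∀ p, TopologicalSpace (E p)]
    [∀ p, IsTopologicalAddGroup (E p)] [∀ p, ContinuousSMul ℂ (E p)]
    [∀ p, ContinuousSMul ℝ (E p)]
    [FiberBundle F E] [VectorBundle ℂ F E] [VectorBundle ℝ F E]
    [ContMDiffVectorBundle ∞ F E (𝓡 3)]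
    (D : CovariantDerivative (𝓡 3) F E)
    (hD_smooth : CovariantDerivative.ContMDiffCovariantDerivative D ∞)
    (hD_complex : ∀ (s : Π p : M, E p) (p : M) (v : TangentSpace (𝓡 3) p),
      MDifferentiableAt (𝓡 3) ((𝓡 3).prod 𝓘(ℝ, F)) (fun q ↦ TotalSpace.mk' F q (s q)) p →
      D (fun q ↦ Complex.I • s q) p v = Complex.I • D s p v)
    -- a Higgs field `φ` with the monopole equation `∇ φ = ½ ⋆ F_∇`
    (φ : Π p : M, E p →L[ℂ] E p) (hφ_smooth : SmoothEndOn (𝓡 3) F φ Set.univ)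
    (hmonopole : ∀ (p : M) (v : TangentSpace (𝓡 3) p) (e : E p),
      endDeriv F D φ p v e =
        (1 / 2 : ℝ) • hodgeStar (o.orient p) (fun a b ↦ curvature F D p a b e) v)
    -- a unit section `σ` of `ξ^⊥` over an open set `U`
    (U : Set M) (hU : IsOpen U)
    (σ : Π p : M, TangentSpace (𝓡 3) p)
    (hσ_smooth : ContMDiffOn (𝓡 3) (𝓡 3).tangent ∞
      (fun p ↦ (⟨p, σ p⟩ : TangentBundle (𝓡 3) M)) U)
    (hσ_unit : ∀ p ∈ U, ‖σ p‖ = 1) (hσ_orth : ∀ p ∈ U, inner ℝ (σ p) (ξ p) = 0)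
    (ψ : Π p : M, E p →L[ℂ] E p) (hψ_smooth : SmoothEndOn (𝓡 3) F ψ U) :
    let jσ : Π p : M, TangentSpace (𝓡 3) p := fun p ↦ transverseJ (o.orient p) (ξ p) (σ p)
    -- `Z = σ - i jσ` and its conjugate, as complex tangent vectors of `M`
    let Z : Π p : M, TangentSpace (𝓡 3) p × TangentSpace (𝓡 3) p := fun p ↦ (σ p, -jσ p)
    let Zbar : Π p : M, TangentSpace (𝓡 3) p × TangentSpace (𝓡 3) p := fun p ↦ (σ p, jσ p)
    let D' := coneConnection D φ c
    let ϕ : Π p : M, E p →L[ℂ] E p := fun p ↦ (-2 * Complex.I) • φ p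
    let Dhat := hatConnection D ξ ϕ
    -- `∂bar_E (π^* ψ) = ι_Z F_∇'` over `π⁻¹ U`, where `∂bar_E = ∇' + i J ∇'`
    let cauchyRiemann : Prop := ∀ x : M × ℝ, x.1 ∈ U → 0 < x.2 →
      ∀ (w : TangentSpace ((𝓡 3).prod 𝓘(ℝ, ℝ)) x) (e : ConePullback E x),
        endDeriv F D' (pullbackEnd ψ) x w e
            + Complex.I • endDeriv F D' (pullbackEnd ψ) x (coneJ o.orient ξ c x w) e
          = cext (fun v ↦ curvature F D' x v w e)
              (horizontalLift x (Z x.1).1, horizontalLift x (Z x.1).2)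
    -- `∇_Zbar ψ = 2 i ∇_ξ φ` and `∇_ξ ψ - 2 i [φ, ψ] = -2 i ∇_Z φ` over `U`
    let coupledSystem : Prop := ∀ p ∈ U, ∀ e : E p,
      cext (fun v ↦ endDeriv F D ψ p v e) (Zbar p)
          = (2 * Complex.I) • endDeriv F D φ p (ξ p) e ∧
      endDeriv F D ψ p (ξ p) e - (2 * Complex.I) • (φ p (ψ p e) - ψ p (φ p e))
          = (-2 * Complex.I) • cext (fun v ↦ endDeriv F D φ p v e) (Z p)
    -- `∇̂_Zbar ψ = -∇̂_ξ ϕ` and `∇̂_ξ ψ = ∇̂_Z ϕ` over `U`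
    let hatSystem : Prop := ∀ p ∈ U, ∀ e : E p,
      cext (fun v ↦ endDeriv F Dhat ψ p v e) (Zbar p) = -endDeriv F Dhat ϕ p (ξ p) e ∧
      endDeriv F Dhat ψ p (ξ p) e = cext (fun v ↦ endDeriv F Dhat ϕ p v e) (Z p)
    (cauchyRiemann ↔ coupledSystem) ∧ (coupledSystem ↔ hatSystem) := by
  intro jσ Z Zbar D' ϕ Dhat cauchyRiemann coupledSystem hatSystem
  -- The monopole equation solved for the curvature.
  have hC (p : M) (v w : TangentSpace (𝓡 3) p) (e : E p) :
      curvature F D p v w e = (2 : ℝ) • endDeriv F D φ p (transverseJ (o.orient p) v w) e := by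
    rw [hmonopole, hodgeStar_transverseJ (o.orient p) (fun a b ↦ curvature F D p a b e)
      (fun x y z a b ↦ curvature_add_smul_right D hD_smooth x y z a b e)
      (fun x y ↦ curvature_swap D p x y e), smul_smul]
    norm_num
  have hB_neg (p : M) (v : TangentSpace (𝓡 3) p) (e : E p) :
      endDeriv F D φ p (-v) e = -endDeriv F D φ p v e := by
    have h := endDeriv_add_smul (F := F) D φ p v v (-1) 0 e
    rw [neg_one_smul, zero_smul, add_zero, neg_one_smul, zero_smul, add_zero] at h
    exact h
  have hB_zero (p : M) (e : E p) : endDeriv F D φ p 0 e = 0 := by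
    have h := endDeriv_add_smul (F := F) D φ p 0 0 0 0 e
    simpa using h
  have hC_neg (p : M) (v w : TangentSpace (𝓡 3) p) (e : E p) :
      curvature F D p v (-w) e = -curvature F D p v w e := by
    have h := curvature_add_smul_right D hD_smooth v w w (-1) 0 e
    rw [neg_one_smul, zero_smul, add_zero, neg_one_smul, zero_smul, add_zero] at h
    exact h
  have hxsj (p : M) (hp : p ∈ U) : transverseJ (o.orient p) (σ p) (jσ p) = ξ p :=
    transverseJ_apply_transverseJ_of_orthonormal _ (hσ_unit p hp) (hσ_orth p hp)
  have hjj (p : M) (hp : p ∈ U) : transverseJ (o.orient p) (ξ p) (jσ p) = -σ p :=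
    transverseJ_transverseJ_of_orthonormal _ (hξ_unit p) (hσ_orth p hp)
  have cr_iff (x : M × ℝ) (hx : x.1 ∈ U) (ht : 0 < x.2) (a b n τ : ℝ) (e : E x.1) :
      endDeriv F D' (pullbackEnd ψ) x
          (coneVector x ((1 : ℝ) • (a • σ x.1 + b • jσ x.1) + n • ξ x.1) τ) e
        + Complex.I • endDeriv F D' (pullbackEnd ψ) x (coneJ o.orient ξ c x
          (coneVector x ((1 : ℝ) • (a • σ x.1 + b • jσ x.1) + n • ξ x.1) τ)) e
      = cext (fun v ↦ curvature F D' x v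
            (coneVector x ((1 : ℝ) • (a • σ x.1 + b • jσ x.1) + n • ξ x.1) τ) e)
          (horizontalLift x (Z x.1).1, horizontalLift x (Z x.1).2) ↔
      (a - b * Complex.I) • (cext (fun v ↦ endDeriv F D ψ x.1 v e) (Zbar x.1)
            - (2 * Complex.I) • endDeriv F D φ x.1 (ξ x.1) e)
        + (n + (τ / (2 * (x.2 * √c)) : ℝ) * Complex.I) • (endDeriv F D ψ x.1 (ξ x.1) e
            - (2 * Complex.I) • (φ x.1 (ψ x.1 e) - ψ x.1 (φ x.1 e))
            - (-2 * Complex.I) • cext (fun v ↦ endDeriv F D φ x.1 v e) (Z x.1)) = 0 := by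
    have hr : x.2 * √c ≠ 0 := (mul_pos ht (Real.sqrt_pos.2 hc)).ne'
    have hJ : coneJ o.orient ξ c x
          (coneVector x ((1 : ℝ) • (a • σ x.1 + b • jσ x.1) + n • ξ x.1) τ)
        = coneVector x ((1 : ℝ) • (a • jσ x.1 + (-b) • σ x.1)
            + (τ / (2 * (x.2 * √c))) • ξ x.1) (-(2 * (x.2 * √c)) * n) := by
      rw [coneJ_coneVector, transverseJ_frame_combination _ (hξ_unit x.1) (hσ_orth x.1 hx),
        inner_frame_combination _ (hξ_unit x.1) (hσ_orth x.1 hx), one_smul, mul_assoc]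
    have hL (w : TangentSpace (𝓡 3) x.1) (ρ : ℝ) :=
      endDeriv_coneConnection (F := F) (fun s ↦ D s) φ ψ c x w ρ e
    have hR (v u : TangentSpace (𝓡 3) x.1) (ρ : ℝ) :=
      curvature_coneConnection D hD_smooth hφ_smooth c x v u ρ e
    -- Uses σ × σ = 0, σ × jσ = ξ and σ × ξ = -jσ.
    have hs : curvature F D x.1 (σ x.1) ((1 : ℝ) • (a • σ x.1 + b • jσ x.1) + n • ξ x.1) e
        = (1 : ℝ) • (b • (2 : ℝ) • endDeriv F D φ x.1 (ξ x.1) e)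
          + n • (-2 : ℝ) • endDeriv F D φ x.1 (jσ x.1) e := by
      rw [curvature_add_smul_right D hD_smooth, curvature_add_smul_right D hD_smooth, hC, hC, hC,
        transverseJ_self, hxsj _ hx, transverseJ_swap, hB_neg, hB_zero]
      module
    -- Uses -jσ × σ = ξ, jσ × jσ = 0 and -jσ × ξ = ξ × jσ = -σ.
    have hj : curvature F D x.1 (-jσ x.1)
          ((1 : ℝ) • (a • σ x.1 + b • jσ x.1) + n • ξ x.1) e
        = (1 : ℝ) • (a • (2 : ℝ) • endDeriv F D φ x.1 (ξ x.1) e)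
          + n • (-2 : ℝ) • endDeriv F D φ x.1 (σ x.1) e := by
      rw [curvature_swap, hC_neg, neg_neg, curvature_swap]
      rw [curvature_add_smul_right D hD_smooth, curvature_add_smul_right D hD_smooth, hC, hC, hC,
        transverseJ_self, transverseJ_swap, hxsj _ hx, transverseJ_swap _ _ (ξ x.1), hjj _ hx,
        neg_neg, hB_neg, hB_zero]
      module
    rw [hJ]
    have key := cauchyRiemann_residual_identity (endDeriv F D ψ x.1 (σ x.1) e)
      (endDeriv F D ψ x.1 (jσ x.1) e) (endDeriv F D ψ x.1 (ξ x.1) e)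
      (endDeriv F D φ x.1 (σ x.1) e) (endDeriv F D φ x.1 (jσ x.1) e)
      (endDeriv F D φ x.1 (ξ x.1) e) (φ x.1 (ψ x.1 e) - ψ x.1 (φ x.1 e)) a b n τ _ hr
    simp only [cext, Z, Zbar, hB_neg]
    rw [← key, sub_eq_zero]
    refine Eq.congr ?_ ?_
    · refine (congrArg₂ (fun y z : E x.1 ↦ y + Complex.I • z) (hL _ _) (hL _ _)).trans ?_
      rw [endDeriv_add_smul, endDeriv_add_smul, endDeriv_add_smul, endDeriv_add_smul]
    · refine (congrArg₂ (fun y z : E x.1 ↦ y + Complex.I • z) (hR _ _ _) (hR _ _ _)).trans ?_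
      rw [hs, hj, hB_neg]
  -- The correction ϑ(v) [ϕ, ·] vanishes on σ and jσ, and also when ∇̂ acts on ϕ itself; it survives
  -- only in ∇̂_ξ ψ.
  have hhat : ∀ p ∈ U, ∀ e : E p,
      (cext (fun v ↦ endDeriv F Dhat ψ p v e) (Zbar p)
        = cext (fun v ↦ endDeriv F D ψ p v e) (Zbar p)) ∧
      (endDeriv F Dhat ϕ p (ξ p) e = (-2 * Complex.I) • endDeriv F D φ p (ξ p) e) ∧
      (endDeriv F Dhat ψ p (ξ p) e = endDeriv F D ψ p (ξ p) e
        - (2 * Complex.I) • (φ p (ψ p e) - ψ p (φ p e))) ∧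
      cext (fun v ↦ endDeriv F Dhat ϕ p v e) (Z p)
        = (-2 * Complex.I) • cext (fun v ↦ endDeriv F D φ p v e) (Z p) := by
    intro p hp e
    have hσξ : inner ℝ (ξ p) (σ p) = 0 := by rw [real_inner_comm]; exact hσ_orth p hp
    have hjξ : inner ℝ (ξ p) (jσ p) = 0 := inner_transverseJ_self _ _ _
    have hϕ (v : TangentSpace (𝓡 3) p) : endDeriv F D ϕ p v e
        = (-2 * Complex.I) • endDeriv F D φ p v e :=
      endDeriv_neg_two_I_smul D hD_complex hφ_smooth p v e
    have hξξ : inner ℝ (ξ p) (ξ p) = (1 : ℝ) := by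
      rw [real_inner_self_eq_norm_sq, hξ_unit]; norm_num
    simp only [Dhat, endDeriv_hatConnection, cext, Z, Zbar, hϕ, hσξ, hjξ, hξξ, inner_neg_right,
      neg_zero, zero_smul, add_zero, sub_self, smul_zero, one_smul]
    refine ⟨trivial, trivial, ?_, ?_⟩
    · change _ + ((-2 * Complex.I) • φ p (ψ p e) - ψ p ((-2 * Complex.I) • φ p e)) = _
      rw [map_smul]
      module
    · module
  constructor
  · constructor
    · intro h p hp e
      constructor
      -- Testing at w = σ isolates the first equation, and w = ξ below isolates the second. With τ =
      -- 0 the height does not enter, so t = 1 serves.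
      · have := (cr_iff (p, 1) hp one_pos 1 0 0 0 e).1 (h (p, 1) hp one_pos _ e)
        simpa [sub_eq_zero] using this
      · have := (cr_iff (p, 1) hp one_pos 0 0 1 0 e).1 (h (p, 1) hp one_pos _ e)
        simpa [sub_eq_zero, add_eq_zero_iff_eq_neg] using this
    · intro h x hx ht w e
      obtain ⟨v, τ⟩ : TangentSpace (𝓡 3) x.1 × ℝ := w
      obtain ⟨a, b, n, rfl⟩ := exists_eq_frame_combination (o.orient x.1) (hξ_unit x.1)
        (hσ_unit x.1 hx) (hσ_orth x.1 hx) v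
      refine (cr_iff x hx ht a b n τ e).2 ?_
      obtain ⟨h1, h2⟩ := h x.1 hx e
      rw [h1, h2, sub_self, sub_self, smul_zero, smul_zero, add_zero]
  · refine forall₂_congr fun p hp ↦ forall_congr' fun e ↦ ?_
    obtain ⟨h1, h2, h3, h4⟩ := hhat p hp e
    rw [h1, h2, h3, h4, ← neg_smul, neg_mul, neg_neg]
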